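/- The set of real numbers $k>0$ such that $\cos k\,\cosh k=1$ is the range of a unique strictly increasing sequence $0<k_1<k_2<\dots<k_n<\dots$ (indexed by $n\in\{1,2,\dots\}$). For every $n\ge 1$, $k_n^4$ is the $n$-th eigenvalue of the clamped problem $$\varphi''''=\mu\,\varphi\ \text{ in }(0,1),\qquad \varphi(0)=\varphi'(0)=\varphi(1)=\varphi'(1)=0 ;$$ that is, the set of all $\mu\in\mathbb{C}$ for which this problem has a nonzero complex-valued solution $\varphi\in H^2(0,1)$ (the equation being understood in the sense of distributions) is exactly $\{k_n^4 : n\ge 1\}$, and each of these eigenvalues is simple (its eigenspace has dimension one). Moreover $$k_n\ \ge\ n\pi\qquad\text{for all } n\ge 1.$$ -/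

import Mathlib

open Set Real MeasureTheory
open scoped ContDiff

/-- The threshold wavenumbers of the clamped strip: the `k > 0` with `cos k cosh k = 1`. -/
def clampedThresholds : Set ℝ := {k : ℝ | 0 < k ∧ Real.cos k * Real.cosh k = 1}

/-- `k` lists the threshold wavenumbers in increasing order: `0 < k₁ < k₂ < ⋯`. -/
def IsThresholdSequence (k : ℕ+ → ℝ) : Prop :=
  StrictMono k ∧ Set.range k = clampedThresholds

/-- Test functions on the open interval `(0,1)`. -/
def IsTestFunction (ψ : ℝ → ℝ) : Prop :=
  ContDiff ℝ ∞ ψ ∧ HasCompactSupport ψ ∧ tsupport ψ ⊆ Ioo 0 1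

/-- `v` is the weak derivative of `u` on `(0,1)`. -/
def HasWeakDeriv (u v : ℝ → ℂ) : Prop :=
  ∀ ψ : ℝ → ℝ, IsTestFunction ψ →
    ∫ y in (0 : ℝ)..1, deriv ψ y • u y = -∫ y in (0 : ℝ)..1, ψ y • v y

/-- `φ`, restricted to `[0,1]`, is the `C¹` representative (which exists and is unique by the
embedding `H²(0,1) ⊂ C¹([0,1])`) of an element of the Sobolev space `H²(0,1)`: its second weak
derivative is square integrable. Values of `φ` outside `[0,1]` play no role. -/
def MemH2 (φ : ℝ → ℂ) : Prop :=
  ContDiffOn ℝ 1 φ (Icc 0 1) ∧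
    ∃ v : ℝ → ℂ, MemLp v 2 (volume.restrict (Ioo (0 : ℝ) 1)) ∧
      HasWeakDeriv (derivWithin φ (Icc 0 1)) v

/-- `φ` is an element of `H²(0,1)` with `φ = φ' = 0` at `0` and at `1`. -/
def MemH2Zero (φ : ℝ → ℂ) : Prop :=
  MemH2 φ ∧ φ 0 = 0 ∧ φ 1 = 0 ∧
    derivWithin φ (Icc 0 1) 0 = 0 ∧ derivWithin φ (Icc 0 1) 1 = 0

/-- `φ` is an eigenfunction for `μ` of `d⁴/dy⁴` on `(0,1)` with clamped conditions: a nonzero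
element of `H²(0,1)` with `φ = φ' = 0` at the end points and `d⁴φ/dy⁴ - μ φ = 0` in the sense of
distributions on `(0,1)`. -/
def IsClampedEigenfunction (μ : ℂ) (φ : ℝ → ℂ) : Prop :=
  MemH2Zero φ ∧ (∃ y ∈ Icc (0 : ℝ) 1, φ y ≠ 0) ∧
    ∀ ψ : ℝ → ℝ, IsTestFunction ψ →
      ∫ y in (0 : ℝ)..1, iteratedDeriv 4 ψ y • φ y = μ * ∫ y in (0 : ℝ)..1, ψ y • φ y

/-- `μ` is an eigenvalue of `d⁴/dy⁴` on `(0,1)` with clamped conditions. -/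
def IsClampedEigenvalue (μ : ℂ) : Prop :=
  ∃ φ : ℝ → ℂ, IsClampedEigenfunction μ φ

/-- `μ` is a simple eigenvalue: its eigenfunctions span a line (of functions on `[0,1]`). -/
def IsSimpleClampedEigenvalue (μ : ℂ) : Prop :=
  ∃ φ : ℝ → ℂ, IsClampedEigenfunction μ φ ∧
    ∀ χ : ℝ → ℂ, IsClampedEigenfunction μ χ → ∃ c : ℂ, ∀ y ∈ Icc (0 : ℝ) 1, χ y = c * φ y

/-! Roots: write A(x) = arctan (sinh x), so that cos A(x) = 1 / cosh x and the equation becomes cos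
x = cos A(x), i.e. x - A(x) or x + A(x) is a multiple of 2π. Since 0 < A < π/2 for x > 0, and both x
- A and x + A increase, each interval (nπ, (n+1)π) with n ≥ 1 holds exactly one root and (0, π)
holds none. This gives the sequence and the bound (`exists_clampedThreshold`,
`clampedThreshold_unique`, `exists_mem_Ioo_of_mem_clampedThresholds`).

Spectrum: four integrations of the weak equation make a distributional solution classical
(`exists_weak_primitive`). The energy identity forces μ = k⁴ with k > 0. The solution is then
explicit in its data g''(0), g'''(0) (`IsClampedSolution.formula`), and the conditions at 1 form a
2×2 linear system in g'''(0) and k g''(0), singular exactly when cos k cosh k = 1. At such k the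
system still has a nonzero coefficient, so its kernel is a line, spanned by the data of
`clampedMode`. -/

/-! ### Test functions and weak derivatives -/

namespace IsTestFunction

variable {ψ η : ℝ → ℝ}

lemma deriv (h : IsTestFunction ψ) : IsTestFunction (deriv ψ) :=
  ⟨(contDiff_infty_iff_deriv.1 h.1).2, h.2.1.deriv, tsupport_deriv_subset.trans h.2.2⟩

lemma hasDerivAt (h : IsTestFunction ψ) (x : ℝ) : HasDerivAt ψ (_root_.deriv ψ x) x :=
  ((contDiff_infty_iff_deriv.1 h.1).1 x).hasDerivAt

lemma eq_zero (h : IsTestFunction ψ) {x : ℝ} (hx : x ∉ Ioo (0 : ℝ) 1) : ψ x = 0 :=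
  image_eq_zero_of_notMem_tsupport fun hx' => hx (h.2.2 hx')

lemma continuous (h : IsTestFunction ψ) : Continuous ψ := h.1.continuous

lemma continuous_iteratedDeriv (h : IsTestFunction ψ) (n : ℕ) :
    Continuous (iteratedDeriv n ψ) :=
  h.1.continuous_iteratedDeriv n (by exact_mod_cast le_top)

lemma integral_deriv_smul (h : IsTestFunction ψ) {u u' : ℝ → ℂ}
    (hu : ∀ x, HasDerivAt u (u' x) x) (hu' : Continuous u') :
    ∫ y in (0 : ℝ)..1, _root_.deriv ψ y • u y = -∫ y in (0 : ℝ)..1, ψ y • u' y := by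
  have := intervalIntegral.integral_smul_deriv_eq_deriv_smul (a := 0) (b := 1)
    (fun x _ => h.hasDerivAt x) (fun x _ => hu x)
    (h.deriv.continuous.intervalIntegrable _ _) (hu'.intervalIntegrable _ _)
  rw [this, h.eq_zero (by simp), h.eq_zero (by simp)]
  simp

lemma sub_const_mul (h : IsTestFunction ψ) (h' : IsTestFunction η) (c : ℝ) :
    IsTestFunction (fun x => ψ x - c * η x) := by
  refine ⟨h.1.sub (contDiff_const.mul h'.1), h.2.1.sub h'.2.1.mul_left, ?_⟩
  refine (tsupport_sub ψ (fun x => c * η x)).trans (union_subset h.2.2 ?_)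
  exact (tsupport_mul_subset_right (f := fun _ => c)).trans h'.2.2

/-- A test function of vanishing integral is the derivative of a test function. -/
lemma exists_primitive (h : IsTestFunction ψ) (h0 : ∫ y in (0 : ℝ)..1, ψ y = 0) :
    ∃ χ, IsTestFunction χ ∧ _root_.deriv χ = ψ := by
  have hd : ∀ x, HasDerivAt (fun x => ∫ y in (0 : ℝ)..x, ψ y) (ψ x) x := fun x =>
    h.continuous.integral_hasStrictDerivAt 0 x |>.hasDerivAt
  have hderiv : _root_.deriv (fun x => ∫ y in (0 : ℝ)..x, ψ y) = ψ :=
    funext fun x => (hd x).deriv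
  obtain ⟨a, b, ha, hb, hab⟩ : ∃ a b : ℝ, 0 < a ∧ b < 1 ∧ tsupport ψ ⊆ Icc a b := by
    rcases (tsupport ψ).eq_empty_or_nonempty with he | hne
    -- For ψ = 0 any empty interval serves; here it is `Icc 1 0`.
    · exact ⟨1, 0, one_pos, one_pos, by simp [he]⟩
    · obtain ⟨a, ha, ha'⟩ := h.2.1.isCompact.exists_isLeast hne
      obtain ⟨b, hb, hb'⟩ := h.2.1.isCompact.exists_isGreatest hne
      exact ⟨a, b, (h.2.2 ha).1, (h.2.2 hb).2, fun x hx => ⟨ha' hx, hb' hx⟩⟩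
  have hz : ∀ x, x ∉ Icc a b → ψ x = 0 := fun x hx =>
    image_eq_zero_of_notMem_tsupport fun hx' => hx (hab hx')
  have hsupp : Function.support (fun x => ∫ y in (0 : ℝ)..x, ψ y) ⊆ Icc a b := by
    intro x hx
    by_contra hx'
    apply hx
    by_cases hxa : x < a
    · refine (intervalIntegral.integral_congr (g := fun _ => 0) fun y hy => ?_).trans (by simp)
      refine hz y fun hy' => ?_
      have := hy.2.trans (max_lt ha hxa).le
      rcases eq_or_lt_of_le (hy'.1.trans this) with h | h
      · exact absurd hy.2 (not_le.2 ((max_lt ha hxa).trans_le hy'.1))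
      · exact lt_irrefl _ h
    · have hbx : b < x := by
        by_contra hbx
        exact hx' ⟨not_lt.1 hxa, not_lt.1 hbx⟩
      have hi := fun s t => h.continuous.intervalIntegrable (μ := volume) s t
      change ∫ y in (0 : ℝ)..x, ψ y = 0
      rw [← intervalIntegral.integral_add_adjacent_intervals (hi 0 1) (hi 1 x), h0, zero_add]
      refine (intervalIntegral.integral_congr (g := fun _ => 0) fun y hy => ?_).trans (by simp)
      exact hz y fun hy' => absurd hy.1 (not_le.2 (hy'.2.trans_lt (lt_min hb hbx)))
  have htsupp : tsupport (fun x => ∫ y in (0 : ℝ)..x, ψ y) ⊆ Icc a b :=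
    closure_minimal hsupp isClosed_Icc
  refine ⟨_, ⟨?_, HasCompactSupport.intro isCompact_Icc (K := Icc a b) fun x hx => ?_, ?_⟩, hderiv⟩
  · rw [contDiff_infty_iff_deriv, hderiv]
    exact ⟨fun x => (hd x).differentiableAt, h.1⟩
  · by_contra hne
    exact hx (hsupp hne)
  · exact htsupp.trans fun x hx => ⟨ha.trans_le hx.1, hx.2.trans_lt hb⟩

lemma exists_integral_eq_one : ∃ θ, IsTestFunction θ ∧ ∫ y in (0 : ℝ)..1, θ y = 1 := by
  let f : ContDiffBump (1 / 2 : ℝ) := ⟨1 / 8, 1 / 4, by norm_num, by norm_num⟩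
  have hts : tsupport (f.normed volume) ⊆ Ioo 0 1 := by
    rw [f.tsupport_normed_eq, Real.closedBall_eq_Icc]
    intro x hx
    have h1 : (1 / 2 : ℝ) - 1 / 4 ≤ x := hx.1
    have h2 : x ≤ (1 / 2 : ℝ) + 1 / 4 := hx.2
    constructor <;> linarith
  refine ⟨f.normed volume, ⟨f.contDiff_normed, f.hasCompactSupport_normed, hts⟩, ?_⟩
  rw [intervalIntegral.integral_eq_integral_of_support_subset, f.integral_normed]
  exact (subset_tsupport _).trans (hts.trans Ioo_subset_Ioc_self)

end IsTestFunction

/-- One step of regularity: an identity `D^(n+1) w = ± f` in the sense of distributions can be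
integrated once. -/
lemma exists_weak_primitive (n : ℕ) {w f : ℝ → ℂ} (hw : Continuous w) (hf : Continuous f)
    (h : ∀ ψ, IsTestFunction ψ →
      ∫ y in (0 : ℝ)..1, iteratedDeriv (n + 1) ψ y • w y = ∫ y in (0 : ℝ)..1, ψ y • f y) :
    ∃ G : ℝ → ℂ, (∀ x, HasDerivAt G (-f x) x) ∧ ∀ ψ, IsTestFunction ψ →
      ∫ y in (0 : ℝ)..1, iteratedDeriv n ψ y • w y = ∫ y in (0 : ℝ)..1, ψ y • G y := by
  obtain ⟨θ, hθ, hθ1⟩ := IsTestFunction.exists_integral_eq_one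
  set F : ℝ → ℂ := fun x => -∫ y in (0 : ℝ)..x, f y with hF
  have hFd : ∀ x, HasDerivAt F (-f x) x := fun x =>
    (hf.integral_hasStrictDerivAt 0 x).hasDerivAt.neg
  have hFc : Continuous F := continuous_iff_continuousAt.2 fun x => (hFd x).continuousAt
  -- The constant of integration is the one that makes the claim true for θ. A general η is then
  -- handled through η - cθ, which has integral zero and so is the derivative of a test function.
  set A : ℂ := (∫ y in (0 : ℝ)..1, iteratedDeriv n θ y • w y) - ∫ y in (0 : ℝ)..1, θ y • F y
    with hA
  refine ⟨fun x => F x + A, fun x => (hFd x).add_const A, fun η hη => ?_⟩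
  set c : ℝ := ∫ y in (0 : ℝ)..1, η y with hc
  have hint : ∀ {p : ℝ → ℝ} {q : ℝ → ℂ}, Continuous p → Continuous q →
      IntervalIntegrable (fun y => p y • q y) volume 0 1 := fun hp hq =>
    (hp.smul hq).intervalIntegrable _ _
  obtain ⟨χ, hχ, hχd⟩ := (hη.sub_const_mul hθ c).exists_primitive (by
    rw [intervalIntegral.integral_sub (hη.continuous.intervalIntegrable _ _)
      ((hθ.continuous.const_mul c).intervalIntegrable _ _),
      intervalIntegral.integral_const_mul, hθ1, ← hc]
    ring)
  have h1 := h χ hχ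
  have h2 := hχ.integral_deriv_smul hFd hf.neg
  have hD : iteratedDeriv (n + 1) χ = fun x => iteratedDeriv n η x - c * iteratedDeriv n θ x := by
    have hle : (n : ℕ∞ω) ≤ ∞ := by exact_mod_cast le_top
    rw [iteratedDeriv_succ', hχd]
    ext x
    rw [iteratedDeriv_fun_sub (hη.1.of_le hle).contDiffAt
      ((contDiff_const.mul hθ.1).of_le hle).contDiffAt,
      iteratedDeriv_const_mul_field]
  have e1 : ∫ y in (0 : ℝ)..1, iteratedDeriv (n + 1) χ y • w y =
      (∫ y in (0 : ℝ)..1, iteratedDeriv n η y • w y) -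
        c * ∫ y in (0 : ℝ)..1, iteratedDeriv n θ y • w y := by
    rw [hD, ← intervalIntegral.integral_const_mul, ← intervalIntegral.integral_sub
      (hint (hη.continuous_iteratedDeriv n) hw)
      ((hint (hθ.continuous_iteratedDeriv n) hw).const_mul _)]
    refine intervalIntegral.integral_congr fun y _ => ?_
    simp only [Complex.real_smul]
    push_cast
    ring
  have e2 : ∫ y in (0 : ℝ)..1, deriv χ y • F y =
      (∫ y in (0 : ℝ)..1, η y • F y) - c * ∫ y in (0 : ℝ)..1, θ y • F y := by
    rw [hχd, ← intervalIntegral.integral_const_mul, ← intervalIntegral.integral_sub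
      (hint hη.continuous hFc) ((hint hθ.continuous hFc).const_mul _)]
    refine intervalIntegral.integral_congr fun y _ => ?_
    simp only [Complex.real_smul]
    push_cast
    ring
  have e3 : ∫ y in (0 : ℝ)..1, η y • (F y + A) = (∫ y in (0 : ℝ)..1, η y • F y) + c * A := by
    simp_rw [smul_add]
    rw [intervalIntegral.integral_add (hint hη.continuous hFc)
      (hint hη.continuous continuous_const), intervalIntegral.integral_smul_const,
      Complex.real_smul]
  have e4 : -∫ y in (0 : ℝ)..1, χ y • -f y = ∫ y in (0 : ℝ)..1, χ y • f y := by
    simp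
  rw [e3, hA]
  linear_combination -e1 + h1 + e2 - h2 - e4

/-- The fundamental lemma of the calculus of variations gives equality a.e. on the open interval;
continuity extends it to every point, end points included. -/
lemma eqOn_of_integral_smul_eq {w G : ℝ → ℂ} (hw : Continuous w) (hG : Continuous G)
    (h : ∀ ψ, IsTestFunction ψ →
      ∫ y in (0 : ℝ)..1, ψ y • w y = ∫ y in (0 : ℝ)..1, ψ y • G y) :
    EqOn w G (Icc 0 1) := by
  have hc : Continuous fun x => w x - G x := hw.sub hG
  have hae : ∀ᵐ x ∂(volume : Measure ℝ), x ∈ Ioo (0 : ℝ) 1 → w x - G x = 0 := by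
    refine isOpen_Ioo.ae_eq_zero_of_integral_contDiff_smul_eq_zero
      (hc.locallyIntegrable.locallyIntegrableOn _) fun g hg hg' hgs => ?_
    have ht : IsTestFunction g := ⟨hg, hg', hgs⟩
    rw [← intervalIntegral.integral_eq_integral_of_support_subset (a := 0) (b := 1)]
    · simp_rw [smul_sub]
      rw [intervalIntegral.integral_sub, h g ht, sub_self]
      · exact (hg.continuous.smul hw).intervalIntegrable _ _
      · exact (hg.continuous.smul hG).intervalIntegrable _ _
    · intro x hx
      by_contra hx'
      exact hx (by simp [ht.eq_zero fun h => hx' (Ioo_subset_Ioc_self h)])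
  refine Measure.eqOn_Icc_of_ae_eq volume zero_ne_one ?_ hw.continuousOn hG.continuousOn
  rw [Filter.EventuallyEq, ae_restrict_iff' measurableSet_Icc]
  filter_upwards [hae, compl_mem_ae_iff.2 (measure_singleton (μ := (volume : Measure ℝ)) 0),
    compl_mem_ae_iff.2 (measure_singleton (μ := (volume : Measure ℝ)) 1)] with x hx hx0 hx1 hxI
  exact sub_eq_zero.1
    (hx ⟨lt_of_le_of_ne hxI.1 (Ne.symm hx0), lt_of_le_of_ne hxI.2 hx1⟩)

/-! ### The roots of `cos k * cosh k = 1` -/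

lemma cos_arctan_sinh (x : ℝ) : cos (arctan (sinh x)) = 1 / cosh x := by
  rw [cos_arctan, ← cosh_sq', sqrt_sq (cosh_pos x).le]

lemma arctan_sinh_pos {x : ℝ} (hx : 0 < x) : 0 < arctan (sinh x) :=
  arctan_pos.2 (sinh_pos_iff.2 hx)

lemma mem_clampedThresholds_iff {x : ℝ} :
    x ∈ clampedThresholds ↔ 0 < x ∧ cos x = cos (arctan (sinh x)) := by
  rw [cos_arctan_sinh, eq_div_iff (cosh_pos x).ne']
  rfl

lemma strictMono_add_arctan_sinh : StrictMono fun x : ℝ => x + arctan (sinh x) :=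
  strictMono_id.add (arctan_strictMono.comp sinh_strictMono)

/-- The derivative is 1 - 1 / cosh x, positive for x > 0. -/
lemma strictMonoOn_sub_arctan_sinh : StrictMonoOn (fun x : ℝ => x - arctan (sinh x)) (Ici 0) := by
  refine strictMonoOn_of_deriv_pos (convex_Ici 0)
    (continuous_id.sub (continuous_arctan.comp continuous_sinh)).continuousOn fun x hx => ?_
  rw [interior_Ici] at hx
  have hd : HasDerivAt (fun x : ℝ => x - arctan (sinh x)) (1 - 1 / (1 + sinh x ^ 2) * cosh x) x :=
    (hasDerivAt_id x).sub (hasDerivAt_sinh x).arctan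
  have hc : 1 < cosh x := one_lt_cosh.2 hx.ne'
  rw [hd.deriv, ← cosh_sq', sub_pos, one_div_mul_eq_div, div_lt_one (by positivity)]
  nlinarith

/-- Equal cosines leave two families, indexed by an integer; both x - A(x) and x + A(x) are positive
for x > 0, so that integer is at least 1. -/
lemma exists_nat_of_mem_clampedThresholds {x : ℝ} (hx : x ∈ clampedThresholds) :
    ∃ m : ℕ, 1 ≤ m ∧ (x - arctan (sinh x) = 2 * m * π ∨ x + arctan (sinh x) = 2 * m * π) := by
  obtain ⟨h0, h⟩ := mem_clampedThresholds_iff.1 hx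
  have hA := arctan_sinh_pos h0
  have hm : 0 < x - arctan (sinh x) := by
    have := strictMonoOn_sub_arctan_sinh self_mem_Ici h0.le h0
    simpa using this
  have key : ∀ (z : ℤ) (y : ℝ), 0 < y → y = 2 * z * π → ∃ m : ℕ, 1 ≤ m ∧ y = 2 * m * π := by
    intro z y hy hz
    have hz0 : 0 < z := by
      by_contra hneg
      have : (z : ℝ) ≤ 0 := by exact_mod_cast not_lt.1 hneg
      nlinarith [pi_pos]
    lift z to ℕ using hz0.le
    exact ⟨z, by exact_mod_cast hz0, by simpa using hz⟩
  obtain ⟨z, hz | hz⟩ := cos_eq_cos_iff.1 h.symm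
  · obtain ⟨m, hm1, hm2⟩ := key z _ hm (by linarith)
    exact ⟨m, hm1, Or.inl hm2⟩
  · obtain ⟨m, hm1, hm2⟩ := key z (x + arctan (sinh x)) (by linarith) (by linarith)
    exact ⟨m, hm1, Or.inr hm2⟩

/-- As 0 < A(x) < π/2, a root of the first family lies just above 2mπ (n = 2m), one of the second
just below (n = 2m - 1). -/
lemma exists_mem_Ioo_of_mem_clampedThresholds {x : ℝ} (hx : x ∈ clampedThresholds) :
    ∃ n : ℕ+, x ∈ Ioo (n * π) ((n + 1) * π) := by
  have hA := arctan_sinh_pos hx.1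
  have hA' := arctan_lt_pi_div_two (sinh x)
  obtain ⟨m, hm, h | h⟩ := exists_nat_of_mem_clampedThresholds hx
  · refine ⟨⟨2 * m, by lia⟩, ?_⟩
    simp only [PNat.mk_coe, Nat.cast_mul, Nat.cast_ofNat, mem_Ioo]
    constructor <;> linarith
  · refine ⟨⟨2 * m - 1, by lia⟩, ?_⟩
    simp only [PNat.mk_coe, mem_Ioo]
    rw [Nat.cast_sub (by lia)]
    push_cast
    constructor <;> linarith

lemma eq_of_mul_pi_close {a b : ℕ} {x y : ℝ} (hx : 2 * a * π = x) (hy : 2 * b * π = y)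
    (h1 : x < y + 2 * π) (h2 : y < x + 2 * π) : a = b := by
  subst hx hy
  have h3 : (a : ℝ) < b + 1 := by
    by_contra! h
    nlinarith [pi_pos]
  have h4 : (b : ℝ) < a + 1 := by
    by_contra! h
    nlinarith [pi_pos]
  norm_cast at h3 h4
  lia

/-- The parity of n decides the family and its size decides m; strict monotonicity of x - A(x) or x
+ A(x) does the rest. -/
lemma clampedThreshold_unique {n : ℕ} {x y : ℝ} (hx : x ∈ clampedThresholds)
    (hy : y ∈ clampedThresholds) (hxn : x ∈ Ioo (n * π) ((n + 1) * π))
    (hyn : y ∈ Ioo (n * π) ((n + 1) * π)) : x = y := by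
  have hAx := arctan_sinh_pos hx.1
  have hAx' := arctan_lt_pi_div_two (sinh x)
  have hAy := arctan_sinh_pos hy.1
  have hAy' := arctan_lt_pi_div_two (sinh y)
  have hp := pi_pos
  -- a root just above `2mπ` and one just below `2lπ` lie in different intervals
  have mixed : ∀ {x y : ℝ} {m l : ℕ}, x ∈ Ioo (n * π) ((n + 1) * π) →
      y ∈ Ioo (n * π) ((n + 1) * π) → 0 < arctan (sinh x) → arctan (sinh x) < π / 2 →
      0 < arctan (sinh y) → arctan (sinh y) < π / 2 →
      x - arctan (sinh x) = 2 * m * π → y + arctan (sinh y) = 2 * l * π → False := by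
    intro x y m l hx hy h1 h2 h3 h4 hm hl
    have a1 : ((2 * m : ℕ) : ℝ) * π < (n + 1 : ℕ) * π := by push_cast; linarith [hx.2]
    have a2 : ((n : ℕ) : ℝ) * π < (2 * m + 1 : ℕ) * π := by push_cast; linarith [hx.1]
    have a3 : ((n : ℕ) : ℝ) * π < (2 * l : ℕ) * π := by push_cast; linarith [hy.1]
    have a4 : ((2 * l : ℕ) : ℝ) * π < (n + 2 : ℕ) * π := by push_cast; linarith [hy.2]
    have b1 := lt_of_mul_lt_mul_right a1 hp.le
    have b2 := lt_of_mul_lt_mul_right a2 hp.le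
    have b3 := lt_of_mul_lt_mul_right a3 hp.le
    have b4 := lt_of_mul_lt_mul_right a4 hp.le
    norm_cast at b1 b2 b3 b4
    lia
  obtain ⟨m, -, hm | hm⟩ := exists_nat_of_mem_clampedThresholds hx <;>
    obtain ⟨l, -, hl | hl⟩ := exists_nat_of_mem_clampedThresholds hy
  · have := eq_of_mul_pi_close hm.symm hl.symm (by linarith [hxn.2, hyn.1])
      (by linarith [hxn.1, hyn.2])
    exact strictMonoOn_sub_arctan_sinh.injOn hx.1.le hy.1.le (by simp only [hm, hl, this])
  · exact (mixed hxn hyn hAx hAx' hAy hAy' hm hl).elim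
  · exact (mixed hyn hxn hAy hAy' hAx hAx' hl hm).elim
  · have := eq_of_mul_pi_close hm.symm hl.symm (by linarith [hxn.2, hyn.1])
      (by linarith [hxn.1, hyn.2])
    exact strictMono_add_arctan_sinh.injective (by simp only [hm, hl, this])

/-- At nπ and (n+1)π the function cos · cosh takes values of opposite signs and modulus above 1, so
it crosses 1 in between. -/
lemma exists_clampedThreshold (n : ℕ+) :
    ∃ x ∈ clampedThresholds, x ∈ Ioo (n * π) ((n + 1) * π) := by
  have hn : (1 : ℝ) ≤ n := by exact_mod_cast n.2
  have h0 : 0 < n * π := by positivity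
  have hc : Continuous fun x : ℝ => cos x * cosh x := continuous_cos.mul continuous_cosh
  have hlt : (n : ℝ) * π < (n + 1) * π := by linarith [pi_pos]
  have e1 : cos ((n : ℝ) * π) = (-1) ^ (n : ℕ) := cos_nat_mul_pi n
  have e2 : cos (((n : ℝ) + 1) * π) = (-1) ^ ((n : ℕ) + 1) := by
    exact_mod_cast cos_nat_mul_pi (n + 1)
  have c1 : 1 < cosh ((n : ℝ) * π) := one_lt_cosh.2 h0.ne'
  have c2 : 1 < cosh (((n : ℝ) + 1) * π) := one_lt_cosh.2 (h0.trans hlt).ne'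
  rcases (n : ℕ).even_or_odd with he | ho
  · obtain ⟨x, hx, hx'⟩ := intermediate_value_Ioo' hlt.le hc.continuousOn (a := n * π)
      (show (1 : ℝ) ∈ _ by
        simp only [e1, e2, he.neg_one_pow, he.add_one.neg_one_pow]
        constructor <;> linarith)
    exact ⟨x, ⟨h0.trans hx.1, hx'⟩, hx⟩
  · obtain ⟨x, hx, hx'⟩ := intermediate_value_Ioo hlt.le hc.continuousOn (a := n * π)
      (show (1 : ℝ) ∈ _ by
        simp only [e1, e2, ho.neg_one_pow, ho.add_one.neg_one_pow]
        constructor <;> linarith)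
    exact ⟨x, ⟨h0.trans hx.1, hx'⟩, hx⟩

lemma exists_isThresholdSequence :
    ∃ k : ℕ+ → ℝ, IsThresholdSequence k ∧ ∀ n : ℕ+, (n : ℝ) * π ≤ k n := by
  choose k hk hkn using exists_clampedThreshold
  refine ⟨k, ⟨fun n m hnm => ?_, ?_⟩, fun n => (hkn n).1.le⟩
  · have h1 : ((n : ℝ) + 1) ≤ m := by exact_mod_cast PNat.add_one_le_iff.2 hnm
    exact (hkn n).2.trans_le
      ((mul_le_mul_of_nonneg_right h1 pi_pos.le).trans (hkn m).1.le)
  · refine Subset.antisymm (range_subset_iff.2 hk) fun x hx => ?_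
    obtain ⟨n, hn⟩ := exists_mem_Ioo_of_mem_clampedThresholds hx
    exact ⟨n, clampedThreshold_unique (hk n) hx (hkn n) hn⟩

lemma IsThresholdSequence.unique {k l : ℕ+ → ℝ} (hk : IsThresholdSequence k)
    (hl : IsThresholdSequence l) : k = l :=
  (hk.1.range_inj hl.1).1 (hk.2.trans hl.2.symm)

/-! ### Classical solutions of the clamped problem -/

/-- `g` together with `g₁, g₂, g₃`, its derivatives up to order three, is a classical solution
of the clamped problem for `μ`. -/
structure IsClampedSolution (μ : ℂ) (g g₁ g₂ g₃ : ℝ → ℂ) : Prop where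
  hasDerivAt : ∀ x, HasDerivAt g (g₁ x) x
  hasDerivAt₁ : ∀ x, HasDerivAt g₁ (g₂ x) x
  hasDerivAt₂ : ∀ x, HasDerivAt g₂ (g₃ x) x
  hasDerivAt₃ : ∀ x ∈ Icc (0 : ℝ) 1, HasDerivAt g₃ (μ * g x) x
  continuous₃ : Continuous g₃
  left : g 0 = 0
  right : g 1 = 0
  left₁ : g₁ 0 = 0
  right₁ : g₁ 1 = 0

lemma derivWithin_Icc_of_eqOn {φ g g₁ : ℝ → ℂ} (h : EqOn φ g (Icc 0 1))
    (hg : ∀ x, HasDerivAt g (g₁ x) x) : EqOn (derivWithin φ (Icc 0 1)) g₁ (Icc 0 1) := by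
  intro x hx
  rw [derivWithin_congr h (h hx)]
  exact (hg x).hasDerivWithinAt.derivWithin (uniqueDiffOn_Icc zero_lt_one x hx)

lemma eqOn_zero_of_hasDerivAt {g g₁ : ℝ → ℂ} (h : ∀ x ∈ Icc (0 : ℝ) 1, g x = 0)
    (hg : ∀ x, HasDerivAt g (g₁ x) x) : ∀ x ∈ Icc (0 : ℝ) 1, g₁ x = 0 := by
  intro x hx
  rw [← derivWithin_Icc_of_eqOn (φ := fun _ => 0) (fun y hy => (h y hy).symm) hg hx]
  simp

lemma eqOn_zero_of_deriv_eq_zero {g g₁ : ℝ → ℂ} (h : ∀ x ∈ Icc (0 : ℝ) 1, g₁ x = 0)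
    (hg : ∀ x ∈ Icc (0 : ℝ) 1, HasDerivAt g (g₁ x) x) :
    ∀ x ∈ Icc (0 : ℝ) 1, g x = g 0 := by
  refine constant_of_has_deriv_right_zero (fun x hx => (hg x hx).continuousAt.continuousWithinAt)
    fun x hx => ?_
  have := hg x (Ico_subset_Icc_self hx)
  rw [h x (Ico_subset_Icc_self hx)] at this
  exact this.hasDerivWithinAt

/-- Distributional solutions are classical. -/
lemma IsClampedEigenfunction.exists_isClampedSolution {μ : ℂ} {φ : ℝ → ℂ}
    (h : IsClampedEigenfunction μ φ) :
    ∃ g g₁ g₂ g₃, IsClampedSolution μ g g₁ g₂ g₃ ∧ EqOn φ g (Icc 0 1) := by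
  obtain ⟨⟨⟨hφ, -⟩, h0, h1, h0', h1'⟩, -, hw⟩ := h
  -- φ is arbitrary off [0,1]; extending it by its end values gives a function continuous on all of
  -- ℝ.
  set w : ℝ → ℂ := IccExtend zero_le_one ((Icc (0 : ℝ) 1).domRestrict φ) with hwdef
  have hwφ : ∀ x ∈ Icc (0 : ℝ) 1, w x = φ x := fun x hx => by
    rw [hwdef, IccExtend_of_mem _ _ hx, domRestrict_apply]
  have hwc : Continuous w := (continuousOn_iff_continuous_domRestrict.1 hφ.continuousOn).Icc_extend'
  have hcg : ∀ p : ℝ → ℝ, ∫ y in (0 : ℝ)..1, p y • w y = ∫ y in (0 : ℝ)..1, p y • φ y := fun p =>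
    intervalIntegral.integral_congr fun y hy => by
      rw [uIcc_of_le zero_le_one] at hy
      simp only [hwφ y hy]
  have hcont : ∀ {F f : ℝ → ℂ}, (∀ x, HasDerivAt F (f x) x) → Continuous F := fun hF =>
    continuous_iff_continuousAt.2 fun x => (hF x).continuousAt
  obtain ⟨G₁, hG₁, H₁⟩ := exists_weak_primitive 3 (f := fun y => μ * w y) hwc
    (continuous_const.mul hwc) fun ψ hψ => by
      rw [hcg, hw ψ hψ, ← hcg, ← intervalIntegral.integral_const_mul]
      simp only [Complex.real_smul]
      congr 1
      ext y
      ring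
  obtain ⟨G₂, hG₂, H₂⟩ := exists_weak_primitive 2 hwc (hcont hG₁) H₁
  obtain ⟨G₃, hG₃, H₃⟩ := exists_weak_primitive 1 hwc (hcont hG₂) H₂
  obtain ⟨G, hG, H⟩ := exists_weak_primitive 0 hwc (hcont hG₃) H₃
  simp only [iteratedDeriv_zero] at H
  have hwG := eqOn_of_integral_smul_eq hwc (hcont hG) H
  have hφG : EqOn φ G (Icc 0 1) := fun x hx => (hwφ x hx).symm.trans (hwG hx)
  have hd := derivWithin_Icc_of_eqOn hφG hG
  have m0 : (0 : ℝ) ∈ Icc (0 : ℝ) 1 := by simp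
  have m1 : (1 : ℝ) ∈ Icc (0 : ℝ) 1 := by simp
  -- Each integration flips a sign: G' = -G₃, G₃' = -G₂, G₂' = -G₁, G₁' = -μw.
  refine ⟨G, fun x => -G₃ x, G₂, fun x => -G₁ x, ⟨hG, fun x => ?_, hG₂, fun x hx => ?_,
    (hcont hG₁).neg, ?_, ?_, ?_, ?_⟩, hφG⟩
  · exact (hG₃ x).neg.congr_deriv (neg_neg _)
  · rw [← hwG hx]
    exact (hG₁ x).neg.congr_deriv (neg_neg _)
  · rw [← hφG m0, h0]
  · rw [← hφG m1, h1]
  · exact (hd m0).symm.trans h0'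
  · exact (hd m1).symm.trans h1'

/-! ### Energy identity, explicit form of solutions and characteristic equation -/

namespace IsClampedSolution

variable {μ : ℂ} {g g₁ g₂ g₃ : ℝ → ℂ}

lemma continuous (h : IsClampedSolution μ g g₁ g₂ g₃) : Continuous g :=
  continuous_iff_continuousAt.2 fun x => (h.hasDerivAt x).continuousAt

lemma continuous₁ (h : IsClampedSolution μ g g₁ g₂ g₃) : Continuous g₁ :=
  continuous_iff_continuousAt.2 fun x => (h.hasDerivAt₁ x).continuousAt

lemma continuous₂ (h : IsClampedSolution μ g g₁ g₂ g₃) : Continuous g₂ :=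
  continuous_iff_continuousAt.2 fun x => (h.hasDerivAt₂ x).continuousAt

/-- The energy identity `μ ∫ |g|² = ∫ |g''|²`. -/
lemma energy (h : IsClampedSolution μ g g₁ g₂ g₃) :
    μ * ((∫ x in (0 : ℝ)..1, Complex.normSq (g x) : ℝ) : ℂ) =
      ((∫ x in (0 : ℝ)..1, Complex.normSq (g₂ x) : ℝ) : ℂ) := by
  have hc := h.continuous
  have hc2 := h.continuous₂
  have hn : Continuous fun x => ((Complex.normSq (g x) : ℝ) : ℂ) :=
    Complex.continuous_ofReal.comp (Complex.continuous_normSq.comp hc)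
  have hn2 : Continuous fun x => ((Complex.normSq (g₂ x) : ℝ) : ℂ) :=
    Complex.continuous_ofReal.comp (Complex.continuous_normSq.comp hc2)
  -- Two integrations by parts at once: the mixed terms g''' · conj g' cancel, and the clamped
  -- conditions kill the primitive at both ends.
  have hd : ∀ x ∈ uIcc (0 : ℝ) 1, HasDerivAt (fun x => g₃ x * star (g x) - g₂ x * star (g₁ x))
      (μ * (Complex.normSq (g x) : ℝ) - (Complex.normSq (g₂ x) : ℝ)) x := by
    intro x hx
    rw [uIcc_of_le zero_le_one] at hx
    refine (((h.hasDerivAt₃ x hx).mul (h.hasDerivAt x).star).sub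
      ((h.hasDerivAt₂ x).mul (h.hasDerivAt₁ x).star)).congr_deriv ?_
    rw [← Complex.mul_conj, ← Complex.mul_conj]
    simp only [starRingEnd_apply]
    ring
  have key := intervalIntegral.integral_eq_sub_of_hasDerivAt hd
    (((continuous_const.mul hn).sub hn2).intervalIntegrable _ _)
  rw [intervalIntegral.integral_sub ((hn.intervalIntegrable _ _).const_mul μ)
    (hn2.intervalIntegrable _ _), intervalIntegral.integral_const_mul,
    intervalIntegral.integral_ofReal, intervalIntegral.integral_ofReal] at key
  simpa [h.left, h.right, h.left₁, h.right₁, sub_eq_zero] using key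

/-- Eigenvalues are positive. -/
lemma exists_pow_four_eq (h : IsClampedSolution μ g g₁ g₂ g₃)
    (hne : ∃ x ∈ Icc (0 : ℝ) 1, g x ≠ 0) : ∃ k : ℝ, 0 < k ∧ μ = (k : ℂ) ^ 4 := by
  have pos : ∀ {f : ℝ → ℂ}, Continuous f → (∃ x ∈ Icc (0 : ℝ) 1, f x ≠ 0) →
      0 < ∫ x in (0 : ℝ)..1, Complex.normSq (f x) := by
    rintro f hf ⟨x, hx, hfx⟩
    exact intervalIntegral.integral_pos zero_lt_one
      (Complex.continuous_normSq.comp hf).continuousOn (fun _ _ => Complex.normSq_nonneg _)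
      ⟨x, hx, Complex.normSq_pos.2 hfx⟩
  -- If g'' vanished, g would be affine with zero value and slope at 0.
  have hne2 : ∃ x ∈ Icc (0 : ℝ) 1, g₂ x ≠ 0 := by
    by_contra! h2
    have e1 := eqOn_zero_of_deriv_eq_zero h2 fun x _ => h.hasDerivAt₁ x
    simp only [h.left₁] at e1
    have e0 := eqOn_zero_of_deriv_eq_zero e1 fun x _ => h.hasDerivAt x
    simp only [h.left] at e0
    obtain ⟨x, hx, hgx⟩ := hne
    exact hgx (e0 x hx)
  have p0 := pos h.continuous hne
  have p2 := pos h.continuous₂ hne2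
  have he := h.energy
  set I0 := ∫ x in (0 : ℝ)..1, Complex.normSq (g x)
  set I2 := ∫ x in (0 : ℝ)..1, Complex.normSq (g₂ x)
  -- The fourth root of the Rayleigh quotient.
  refine ⟨√√(I2 / I0), by positivity, ?_⟩
  have hs : √√(I2 / I0) ^ 4 = I2 / I0 := by
    rw [show (4 : ℕ) = 2 * 2 from rfl, pow_mul, sq_sqrt (by positivity), sq_sqrt (by positivity)]
  rw [← Complex.ofReal_pow, hs, Complex.ofReal_div,
    eq_div_iff (Complex.ofReal_ne_zero.2 p0.ne'), he]

/-- D⁴ - l⁴ = (D - l)(D³ + lD² + l²D + l³), so the left side y solves y' = l y. -/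
lemma exp_formula (h : IsClampedSolution μ g g₁ g₂ g₃) {l : ℂ} (hl : l ^ 4 = μ) {x : ℝ}
    (hx : x ∈ Icc (0 : ℝ) 1) :
    g₃ x + l * g₂ x + l ^ 2 * g₁ x + l ^ 3 * g x = (g₃ 0 + l * g₂ 0) * Complex.exp (l * x) := by
  have hE : ∀ y : ℝ, HasDerivAt (fun y : ℝ => Complex.exp (-(l * y)))
      (Complex.exp (-(l * y)) * (-(l * 1))) y := fun y =>
    (((Complex.ofRealCLM.hasDerivAt (x := y)).const_mul l).neg).cexp
  have hd : ∀ y ∈ Icc (0 : ℝ) 1, HasDerivAt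
      (fun y : ℝ => (g₃ y + l * g₂ y + l ^ 2 * g₁ y + l ^ 3 * g y) * Complex.exp (-(l * y)))
      ((fun _ => 0) y) y := by
    intro y hy
    refine (((((h.hasDerivAt₃ y hy).add ((h.hasDerivAt₂ y).const_mul l)).add
      ((h.hasDerivAt₁ y).const_mul (l ^ 2))).add ((h.hasDerivAt y).const_mul (l ^ 3))).mul
      (hE y)).congr_deriv ?_
    simp only [Pi.add_apply]
    rw [← hl]
    ring
  have := eqOn_zero_of_deriv_eq_zero (fun _ _ => rfl) hd x hx
  simp only [h.left, h.left₁, Complex.ofReal_zero, mul_zero, neg_zero, Complex.exp_zero, mul_one,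
    add_zero] at this
  rw [← this, mul_assoc, ← Complex.exp_add]
  simp

variable {k : ℝ}

/-- `exp_formula` at the four roots ±k, ±ik is a linear system for g, g', g'', g'''; suitable
combinations isolate g and g'. -/
lemma formula (h : IsClampedSolution ((k : ℂ) ^ 4) g g₁ g₂ g₃) {x : ℝ}
    (hx : x ∈ Icc (0 : ℝ) 1) :
    2 * (k : ℂ) ^ 3 * g x = g₃ 0 * (sinh (k * x) - sin (k * x) : ℝ) +
        k * g₂ 0 * (cosh (k * x) - cos (k * x) : ℝ) ∧
      2 * (k : ℂ) ^ 2 * g₁ x = g₃ 0 * (cosh (k * x) - cos (k * x) : ℝ) +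
        k * g₂ 0 * (sinh (k * x) + sin (k * x) : ℝ) := by
  have hI := Complex.I_sq
  have e1 := h.exp_formula (l := k) rfl hx
  have e2 := h.exp_formula (l := -k) (by ring) hx
  have e3 := h.exp_formula (l := k * Complex.I) (by rw [mul_pow, Complex.I_pow_four, mul_one]) hx
  have e4 := h.exp_formula (l := -k * Complex.I)
    (by rw [mul_pow, Complex.I_pow_four, mul_one]; ring) hx
  have x1 : Complex.exp (k * x) = Complex.cosh (k * x) + Complex.sinh (k * x) :=
    (Complex.cosh_add_sinh _).symm
  have x2 : Complex.exp (-k * x) = Complex.cosh (k * x) - Complex.sinh (k * x) := by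
    rw [Complex.cosh_sub_sinh, neg_mul]
  have x3 : Complex.exp (k * Complex.I * x) =
      Complex.cos (k * x) + Complex.sin (k * x) * Complex.I := by
    rw [← Complex.exp_mul_I]
    ring_nf
  have x4 : Complex.exp (-k * Complex.I * x) =
      Complex.cos (k * x) - Complex.sin (k * x) * Complex.I := by
    rw [show -(k : ℂ) * Complex.I * x = (-(k * x)) * Complex.I by ring, Complex.exp_mul_I,
      Complex.cos_neg, Complex.sin_neg]
    ring
  rw [x1] at e1
  rw [x2] at e2
  rw [x3] at e3
  rw [x4] at e4
  push_cast
  generalize Complex.I = i at *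
  generalize Complex.cos (k * x) = c at *
  generalize Complex.sin (k * x) = s at *
  have i4 : i ^ 4 = 1 := by rw [show (4 : ℕ) = 2 * 2 from rfl, pow_mul, hI]; norm_num
  constructor
  · linear_combination (e1 - e2 + i * (e3 - e4)) / 2 +
      (k * g₂ 0 * c - k * g₂ x + g₃ 0 * s) * hI - (k : ℂ) ^ 3 * g x * i4
  · linear_combination (e1 + e2 - e3 - e4) / 2 + ((k : ℂ) ^ 2 * g₁ x - k * g₂ 0 * s) * hI

end IsClampedSolution

namespace IsClampedSolution

variable {μ : ℂ} {g g₁ g₂ g₃ : ℝ → ℂ} {k : ℝ}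

/-- The boundary conditions at `1`, in terms of the initial values `g₂ 0`, `g₃ 0`. -/
lemma boundary (h : IsClampedSolution ((k : ℂ) ^ 4) g g₁ g₂ g₃) :
    g₃ 0 * (sinh k - sin k : ℝ) + k * g₂ 0 * (cosh k - cos k : ℝ) = 0 ∧
      g₃ 0 * (cosh k - cos k : ℝ) + k * g₂ 0 * (sinh k + sin k : ℝ) = 0 := by
  obtain ⟨h0, h1⟩ := h.formula (x := 1) (by simp)
  rw [h.right, mul_zero, mul_one] at h0
  rw [h.right₁, mul_zero, mul_one] at h1
  exact ⟨h0.symm, h1.symm⟩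

/-- The characteristic equation. -/
lemma mem_clampedThresholds (hk : 0 < k) (h : IsClampedSolution ((k : ℂ) ^ 4) g g₁ g₂ g₃)
    (hne : ∃ x ∈ Icc (0 : ℝ) 1, g x ≠ 0) : k ∈ clampedThresholds := by
  refine ⟨hk, ?_⟩
  by_contra hdet
  obtain ⟨b0, b1⟩ := h.boundary
  -- Up to sign, the determinant of the boundary system; if it is nonzero, Cramer's rule kills both
  -- initial data and hence g.
  have hid : (cosh k - cos k) ^ 2 - (sinh k - sin k) * (sinh k + sin k) =
      2 * (1 - cos k * cosh k) := by
    linear_combination cosh_sq k + sin_sq_add_cos_sq k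
  have hD : (((cosh k - cos k) ^ 2 - (sinh k - sin k) * (sinh k + sin k) : ℝ) : ℂ) ≠ 0 := by
    rw [Complex.ofReal_ne_zero, hid]
    exact mul_ne_zero two_ne_zero (sub_ne_zero.2 fun h => hdet h.symm)
  have hb : g₃ 0 = 0 := by
    refine (mul_eq_zero.1 ?_).resolve_right hD
    push_cast at b0 b1 ⊢
    linear_combination (Complex.cosh k - Complex.cos k) * b1 -
      (Complex.sinh k + Complex.sin k) * b0
  have ha : k * g₂ 0 = 0 := by
    refine (mul_eq_zero.1 ?_).resolve_right hD
    push_cast at b0 b1 ⊢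
    linear_combination (Complex.cosh k - Complex.cos k) * b0 -
      (Complex.sinh k - Complex.sin k) * b1
  obtain ⟨x, hx, hgx⟩ := hne
  have := (h.formula hx).1
  rw [hb, ha, zero_mul, zero_mul, add_zero] at this
  have hk' : 2 * (k : ℂ) ^ 3 ≠ 0 :=
    mul_ne_zero two_ne_zero (pow_ne_zero 3 (Complex.ofReal_ne_zero.2 hk.ne'))
  exact hgx ((mul_eq_zero.1 this).resolve_left hk')

/-- Nonzero classical solutions are eigenfunctions. -/
lemma isClampedEigenfunction (h : IsClampedSolution μ g g₁ g₂ g₃)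
    (h3 : ∀ x, HasDerivAt g₃ (μ * g x) x) (hne : ∃ x ∈ Icc (0 : ℝ) 1, g x ≠ 0) :
    IsClampedEigenfunction μ g := by
  have hd := derivWithin_Icc_of_eqOn (fun x _ => rfl) h.hasDerivAt
  have m0 : (0 : ℝ) ∈ Icc (0 : ℝ) 1 := by simp
  have m1 : (1 : ℝ) ∈ Icc (0 : ℝ) 1 := by simp
  refine ⟨⟨⟨?_, g₂, ?_, fun ψ hψ => ?_⟩, h.left, h.right, (hd m0).trans h.left₁,
    (hd m1).trans h.right₁⟩, hne, fun ψ hψ => ?_⟩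
  · refine (contDiff_one_iff_deriv.2 ⟨fun x => (h.hasDerivAt x).differentiableAt, ?_⟩).contDiffOn
    rw [funext fun x => (h.hasDerivAt x).deriv]
    exact h.continuous₁
  · obtain ⟨C, hC⟩ := isCompact_Icc.exists_bound_of_continuousOn
      (h.continuous₂.continuousOn (s := Icc (0 : ℝ) 1))
    refine MemLp.of_bound h.continuous₂.aestronglyMeasurable C ?_
    filter_upwards [ae_restrict_mem measurableSet_Ioo] with x hx
    exact hC x (Ioo_subset_Icc_self hx)
  · rw [← hψ.integral_deriv_smul h.hasDerivAt₁ h.continuous₂]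
    refine intervalIntegral.integral_congr fun y hy => ?_
    rw [uIcc_of_le zero_le_one] at hy
    simp only [hd hy]
  · rw [iteratedDeriv_eq_iterate]
    change ∫ y in (0 : ℝ)..1, deriv (deriv (deriv (deriv ψ))) y • g y = _
    rw [hψ.deriv.deriv.deriv.integral_deriv_smul h.hasDerivAt h.continuous₁,
      hψ.deriv.deriv.integral_deriv_smul h.hasDerivAt₁ h.continuous₂,
      hψ.deriv.integral_deriv_smul h.hasDerivAt₂ h.continuous₃,
      hψ.integral_deriv_smul h3 (continuous_const.mul h.continuous), neg_neg, neg_neg,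
      ← intervalIntegral.integral_const_mul]
    refine intervalIntegral.integral_congr fun y _ => ?_
    simp only [Complex.real_smul]
    ring

end IsClampedSolution

/-! ### The eigenfunction for a threshold wavenumber -/

/-- The solution of `g'''' = k⁴ g`, `g 0 = g' 0 = 0`, `g 1 = 0`, normalised by
`g'' 0 = -2 k² (sinh k - sin k)`. -/
noncomputable def clampedMode (k x : ℝ) : ℝ :=
  (cosh k - cos k) * (sinh (k * x) - sin (k * x)) -
    (sinh k - sin k) * (cosh (k * x) - cos (k * x))

lemma exists_isClampedSolution_clampedMode {k : ℝ} (hk : k ∈ clampedThresholds) :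
    ∃ g₁ g₂ g₃, IsClampedSolution ((k : ℂ) ^ 4) (fun x => (clampedMode k x : ℂ)) g₁ g₂ g₃ ∧
      (∀ x, HasDerivAt g₃ ((k : ℂ) ^ 4 * (clampedMode k x : ℂ)) x) ∧ g₂ 0 ≠ 0 := by
  set C := cosh k - cos k with hC
  set S := sinh k - sin k with hS
  have hS0 : 0 < S := sub_pos.2 ((sin_lt hk.1).trans (self_lt_sinh_iff.2 hk.1))
  have hm : ∀ x : ℝ, HasDerivAt (fun x => k * x) k x := fun x => by
    simpa using (hasDerivAt_id x).const_mul k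
  have hsh := fun x => (hm x).sinh
  have hch := fun x => (hm x).cosh
  have hs := fun x => (hm x).sin
  have hc := fun x => (hm x).cos
  have d0 : ∀ x, HasDerivAt (clampedMode k)
      (k * (C * (cosh (k * x) - cos (k * x)) - S * (sinh (k * x) + sin (k * x)))) x := fun x =>
    ((((hsh x).sub (hs x)).const_mul C).sub (((hch x).sub (hc x)).const_mul S)).congr_deriv
      (by ring)
  have d1 : ∀ x, HasDerivAt
      (fun x => k * (C * (cosh (k * x) - cos (k * x)) - S * (sinh (k * x) + sin (k * x))))
      (k ^ 2 * (C * (sinh (k * x) + sin (k * x)) - S * (cosh (k * x) + cos (k * x)))) x := fun x =>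
    (((((hch x).sub (hc x)).const_mul C).sub
      (((hsh x).add (hs x)).const_mul S)).const_mul k).congr_deriv (by ring)
  have d2 : ∀ x, HasDerivAt
      (fun x => k ^ 2 * (C * (sinh (k * x) + sin (k * x)) - S * (cosh (k * x) + cos (k * x))))
      (k ^ 3 * (C * (cosh (k * x) + cos (k * x)) - S * (sinh (k * x) - sin (k * x)))) x := fun x =>
    (((((hsh x).add (hs x)).const_mul C).sub
      (((hch x).add (hc x)).const_mul S)).const_mul (k ^ 2)).congr_deriv (by ring)
  have d3 : ∀ x, HasDerivAt
      (fun x => k ^ 3 * (C * (cosh (k * x) + cos (k * x)) - S * (sinh (k * x) - sin (k * x))))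
      (k ^ 4 * clampedMode k x) x := fun x =>
    (((((hch x).add (hc x)).const_mul C).sub
      (((hsh x).sub (hs x)).const_mul S)).const_mul (k ^ 3)).congr_deriv
      (by rw [clampedMode]; ring)
  have d3' : ∀ x, HasDerivAt (fun x => ((k ^ 3 * (C * (cosh (k * x) + cos (k * x)) -
      S * (sinh (k * x) - sin (k * x))) : ℝ) : ℂ)) ((k : ℂ) ^ 4 * (clampedMode k x : ℂ)) x :=
    fun x => (d3 x).ofReal_comp.congr_deriv (by push_cast; ring)
  refine ⟨_, _, _, ⟨fun x => (d0 x).ofReal_comp, fun x => (d1 x).ofReal_comp,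
    fun x => (d2 x).ofReal_comp, fun x _ => d3' x,
    continuous_iff_continuousAt.2 fun x => (d3' x).continuousAt, ?_, ?_, ?_, ?_⟩, d3', ?_⟩
  · simp [clampedMode]
  · rw [Complex.ofReal_eq_zero, clampedMode, mul_one]
    ring
  · simp
  -- The only condition that needs the threshold equation: up to the factor k, g'(1) is the
  -- determinant 2(1 - cos k cosh k).
  · rw [Complex.ofReal_eq_zero, mul_one]
    refine mul_eq_zero_of_right _ ?_
    rw [hC, hS]
    linear_combination cosh_sq k + sin_sq_add_cos_sq k - 2 * hk.2
  · rw [Complex.ofReal_ne_zero]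
    have := hk.1.ne'
    simp [this, hS0.ne']

lemma isClampedEigenfunction_clampedMode {k : ℝ} (hk : k ∈ clampedThresholds) :
    IsClampedEigenfunction ((k : ℂ) ^ 4) fun x => (clampedMode k x : ℂ) := by
  obtain ⟨g₁, g₂, g₃, h, h3, h2⟩ := exists_isClampedSolution_clampedMode hk
  refine h.isClampedEigenfunction h3 ?_
  by_contra! h0
  exact h2 (eqOn_zero_of_hasDerivAt (eqOn_zero_of_hasDerivAt h0 h.hasDerivAt) h.hasDerivAt₁ 0
    (by simp))

/-- Since cosh k - cos k ≠ 0, the condition g(1) = 0 expresses g''(0) through g'''(0), leaving one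
free parameter. -/
lemma isSimpleClampedEigenvalue_of_mem {k : ℝ} (hk : k ∈ clampedThresholds) :
    IsSimpleClampedEigenvalue ((k : ℂ) ^ 4) := by
  refine ⟨_, isClampedEigenfunction_clampedMode hk, fun χ hχ => ?_⟩
  obtain ⟨g, g₁, g₂, g₃, h, hg⟩ := hχ.exists_isClampedSolution
  have hC : (((cosh k - cos k : ℝ)) : ℂ) ≠ 0 := by
    rw [Complex.ofReal_ne_zero, sub_ne_zero]
    exact ((cos_le_one k).trans_lt (one_lt_cosh.2 hk.1.ne')).ne'
  have hk0 : (k : ℂ) ≠ 0 := Complex.ofReal_ne_zero.2 hk.1.ne'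
  have hk' : 2 * (k : ℂ) ^ 3 ≠ 0 := mul_ne_zero two_ne_zero (pow_ne_zero 3 hk0)
  refine ⟨g₃ 0 / (2 * (k : ℂ) ^ 3 * (cosh k - cos k : ℝ)), fun y hy => ?_⟩
  have hb := h.boundary.1
  have hf := (h.formula hy).1
  rw [hg hy, div_mul_eq_mul_div, eq_div_iff (mul_ne_zero hk' hC), clampedMode]
  push_cast at hb hf ⊢
  linear_combination (Complex.cosh k - Complex.cos k) * hf +
    (Complex.cosh (k * y) - Complex.cos (k * y)) * hb

lemma isClampedEigenvalue_iff {μ : ℂ} :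
    IsClampedEigenvalue μ ↔ ∃ k ∈ clampedThresholds, (k : ℂ) ^ 4 = μ := by
  constructor
  · rintro ⟨φ, hφ⟩
    obtain ⟨g, g₁, g₂, g₃, h, hg⟩ := hφ.exists_isClampedSolution
    have hne : ∃ x ∈ Icc (0 : ℝ) 1, g x ≠ 0 := by
      obtain ⟨x, hx, hφx⟩ := hφ.2.1
      exact ⟨x, hx, hg hx ▸ hφx⟩
    obtain ⟨k, hk, rfl⟩ := h.exists_pow_four_eq hne
    exact ⟨k, h.mem_clampedThresholds hk hne, rfl⟩
  · rintro ⟨k, hk, rfl⟩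
    exact ⟨_, isClampedEigenfunction_clampedMode hk⟩

theorem mainTheorem12 :
    (∃! k : ℕ+ → ℝ, IsThresholdSequence k) ∧
    ∀ k : ℕ+ → ℝ, IsThresholdSequence k →
      {μ : ℂ | IsClampedEigenvalue μ} = Set.range (fun n : ℕ+ => ((k n : ℂ)) ^ 4) ∧
      (∀ n : ℕ+, IsSimpleClampedEigenvalue ((k n : ℂ) ^ 4)) ∧
      ∀ n : ℕ+, (n : ℝ) * Real.pi ≤ k n := by
  obtain ⟨r, hr, hrn⟩ := exists_isThresholdSequence
  refine ⟨⟨r, hr, fun k hk => hk.unique hr⟩, fun k hk => ?_⟩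
  obtain rfl := hk.unique hr
  refine ⟨?_, fun n => isSimpleClampedEigenvalue_of_mem (hk.2 ▸ mem_range_self n), hrn⟩
  ext μ
  rw [mem_ofPred_eq, isClampedEigenvalue_iff, ← hk.2, exists_range_iff]
  rfl
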